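/- Identify $S^d\mathbb{C}^2$ with the space of complex binary forms of degree $d$ in variables $x,y$, so that $v^{\otimes d}$ corresponds to the $d$-th power of the linear form $v\in\mathbb{C}^2=\langle x,y\rangle$, and let $\nu_d:\mathbb{P}^1\to\mathbb{P}(S^d\mathbb{C}^2)$, $[v]\mapsto[v^{\otimes d}]$, be the Veronese embedding. The cactus rank $c_d(T)$ of $T\in S^d\mathbb{C}^2$ is the minimal degree of a zero-dimensional scheme $Z\subseteq\mathbb{P}^1$ such that $T$ lies in the linear span $\langle\nu_d(Z)\rangle$. For $T\in S^{d_1}\mathbb{C}^2\otimes S^{d_2}\mathbb{C}^2$, the partially symmetric rank $R_{d_1,d_2}(T)$ is the minimal $r$ such that $T=\sum_{i=1}^r v_i^{\otimes d_1}\otimes w_i^{\otimes d_2}$ with $v_i,w_i\in\mathbb{C}^2$. For $b\ge 1$, let $Z[b]\subset\mathbb{P}^1$ be the zero-dimensional scheme of degree $b$ supported at the point $[x]$, that is, the scheme defined by the ideal $(\partial_y^b)\subset\mathbb{C}[\partial_x,\partial_y]$, where $\partial_x,\partial_y$ are the coordinates on $\mathbb{C}^2$ dual to $x,y$. Proposition.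 Let $d_1,d_2,b_1,b_2$ be integers with $2\le b_i\le d_i/2$ for $i=1,2$, and let $T_i\in S^{d_i}\mathbb{C}^2$ satisfy $c_{d_i}(T_i)=b_i$ and $T_i\in\langle\nu_{d_i}(Z[b_i])\rangle$ for $i=1,2$. Then $$R_{d_1,d_2}(T_1\otimes T_2)\le d_1b_2+d_2b_1+b_1b_2-1.$$ -/

import Mathlib

open MvPolynomial
open scoped TensorProduct

namespace BinaryForms

/-- The space `S^d ℂ²` of binary forms of degree `d`, i.e. homogeneous polynomials of degree `d` in
the variables `x = X 0`, `y = X 1`. The space `ℂ²` itself is `Fin 2 → ℂ`, a vector `v` being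
identified with the linear form `v 0 * x + v 1 * y`. -/
abbrev SymPow (d : ℕ) : Submodule ℂ (MvPolynomial (Fin 2) ℂ) :=
  homogeneousSubmodule (Fin 2) ℂ d

/-- The linear form `v 0 * x + v 1 * y` attached to a vector `v` of `ℂ²`. -/
noncomputable def linForm (v : Fin 2 → ℂ) : MvPolynomial (Fin 2) ℂ :=
  C (v 0) * X 0 + C (v 1) * X 1

theorem linForm_pow_mem (d : ℕ) (v : Fin 2 → ℂ) : linForm v ^ d ∈ SymPow d := by
  have h : (linForm v).IsHomogeneous 1 :=
    (isHomogeneous_C_mul_X (v 0) 0).add (isHomogeneous_C_mul_X (v 1) 1)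
  simpa using h.pow d

/-- The symmetric power `v^{⊗ d}`, as the binary form `(v 0 * x + v 1 * y) ^ d`; on the level of
points this is the Veronese map `ν_d : ℙ¹ → ℙ(S^d ℂ²)`. -/
noncomputable def veronese (d : ℕ) (v : Fin 2 → ℂ) : SymPow d :=
  ⟨linForm v ^ d, linForm_pow_mem d v⟩

/-- The partially symmetric rank `R_{d₁,d₂}(T)`: the minimal number `r` of terms in an expression
`T = ∑ v_i^{⊗ d₁} ⊗ w_i^{⊗ d₂}` with `v_i, w_i ∈ ℂ²`
(with value `⊤` if there is no such expression). -/
noncomputable def partSymRank (d₁ d₂ : ℕ) (T : SymPow d₁ ⊗[ℂ] SymPow d₂) : ℕ∞ :=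
  ⨅ (r : ℕ) (_ : ∃ v w : Fin r → Fin 2 → ℂ,
    T = ∑ i, veronese d₁ (v i) ⊗ₜ[ℂ] veronese d₂ (w i)), (r : ℕ∞)

/-- A zero-dimensional closed subscheme of `ℙ¹ = ℙ(ℂ²)`, given by its saturated homogeneous ideal
in the coordinate ring `ℂ[∂_x, ∂_y]`, where `∂_x = X 0` and `∂_y = X 1` are the coordinates on
`ℂ²` (the basis dual to `x, y`). The scheme has degree `r` when `r` is the dimension of the graded
piece of the coordinate ring of the scheme in every large degree.
The empty scheme (unit ideal, degree `0`) is included. -/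
structure ZeroDimSubscheme where
  /-- the homogeneous ideal -/
  ideal : Ideal (MvPolynomial (Fin 2) ℂ)
  isHomogeneous : ∀ G ∈ ideal, ∀ n : ℕ, homogeneousComponent n G ∈ ideal
  saturated : ∀ G : MvPolynomial (Fin 2) ℂ,
    (∃ N : ℕ, ∀ H ∈ homogeneousSubmodule (Fin 2) ℂ N, G * H ∈ ideal) → G ∈ ideal
  /-- the degree, i.e. the eventual value of the Hilbert function -/
  degree : ℕ
  hilbert : ∀ᶠ t in Filter.atTop,
    Module.finrank ℂ (homogeneousSubmodule (Fin 2) ℂ t ⧸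
      (ideal.restrictScalars ℂ).comap (homogeneousSubmodule (Fin 2) ℂ t).subtype) = degree

/-- The (affine cone over the) linear span `⟨ν_d(Z)⟩` in `S^d ℂ²`: the set cut out by all linear
forms `φ` on `S^d ℂ²` that vanish on the scheme `ν_d(Z)`, i.e. whose pullback `G` under `ν_d`
(a form on `ℂ²`) belongs to the ideal of `Z`. -/
def ZeroDimSubscheme.veroneseSpan (Z : ZeroDimSubscheme) (d : ℕ) : Set (SymPow d) :=
  {F | ∀ (φ : SymPow d →ₗ[ℂ] ℂ) (G : MvPolynomial (Fin 2) ℂ),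
    (∀ v : Fin 2 → ℂ, eval v G = φ (veronese d v)) → G ∈ Z.ideal → φ F = 0}

/-- The cactus rank `c_d(F)` of a binary form `F` of degree `d`: the minimal degree of a
zero-dimensional subscheme `Z` of `ℙ¹` with `F ∈ ⟨ν_d(Z)⟩`. -/
noncomputable def cactusRank (d : ℕ) (F : SymPow d) : ℕ∞ :=
  ⨅ (Z : ZeroDimSubscheme) (_ : F ∈ Z.veroneseSpan d), (Z.degree : ℕ∞)

theorem mem_span_X_pow_iff (b : ℕ) (G : MvPolynomial (Fin 2) ℂ) :
    G ∈ Ideal.span {(X 1 : MvPolynomial (Fin 2) ℂ) ^ b} ↔ ∀ m ∈ G.support, b ≤ m 1 := by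
  have h : ({(X 1 : MvPolynomial (Fin 2) ℂ) ^ b} : Set _) =
      (fun s => monomial s (1 : ℂ)) '' {Finsupp.single (1 : Fin 2) b} := by
    simp [X_pow_eq_monomial]
  rw [h, mem_ideal_span_monomial_image]
  simp

/-- The exponent of the monomial `∂_x^(t-j) ∂_y^j`. -/
noncomputable def expo (t j : ℕ) : Fin 2 →₀ ℕ :=
  Finsupp.single 0 (t - j) + Finsupp.single 1 j

theorem expo_one (t j : ℕ) : expo t j 1 = j := by simp [expo]

theorem eq_expo {t : ℕ} {m : Fin 2 →₀ ℕ} (h : m.degree = t) : m = expo t (m 1) := by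
  have h2 : m 0 + m 1 = t := by
    rw [← h, Finsupp.degree_eq_sum]; simp
  ext i
  fin_cases i
  · simp [expo]
    omega
  · simp [expo]

theorem hilbert_span_X_pow (b t : ℕ) (hbt : b ≤ t) :
    Module.finrank ℂ (homogeneousSubmodule (Fin 2) ℂ t ⧸
      ((Ideal.span {(X 1 : MvPolynomial (Fin 2) ℂ) ^ b}).restrictScalars ℂ).comap
        (homogeneousSubmodule (Fin 2) ℂ t).subtype) = b := by
  let L : homogeneousSubmodule (Fin 2) ℂ t →ₗ[ℂ] (Fin b → ℂ) :=
    LinearMap.pi fun j => (lcoeff ℂ (expo t j)) ∘ₗ (homogeneousSubmodule (Fin 2) ℂ t).subtype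
  have hL : ∀ F j, L F j = coeff (expo t j) F.1 := fun F j => rfl
  have hker : LinearMap.ker L =
      ((Ideal.span {(X 1 : MvPolynomial (Fin 2) ℂ) ^ b}).restrictScalars ℂ).comap
        (homogeneousSubmodule (Fin 2) ℂ t).subtype := by
    ext F
    simp only [LinearMap.mem_ker, Submodule.mem_comap, Submodule.restrictScalars_mem,
      Submodule.subtype_apply, mem_span_X_pow_iff]
    constructor
    · intro h m hm
      by_contra hlt
      have hdeg : m.degree = t := by
        by_contra hne
        exact (mem_support_iff.mp hm)
          (IsHomogeneous.coeff_eq_zero ((mem_homogeneousSubmodule t _).mp F.2) hne)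
      have h1 := congrFun h ⟨m 1, not_le.mp hlt⟩
      rw [hL] at h1
      have h2 := eq_expo hdeg
      simp only [Pi.zero_apply] at h1
      rw [← h2] at h1
      exact (mem_support_iff.mp hm) h1
    · intro h
      funext j
      rw [hL]
      by_contra hne
      have := h _ (mem_support_iff.mpr hne)
      rw [expo_one] at this
      exact absurd j.2 (not_lt.mpr this)
  have hsurj : Function.Surjective L := by
    intro c
    refine ⟨⟨∑ j : Fin b, monomial (expo t j) (c j), ?_⟩, ?_⟩
    · refine Submodule.sum_mem _ fun j _ => ?_
      rw [mem_homogeneousSubmodule]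
      refine isHomogeneous_monomial _ ?_
      have := j.2
      simp only [expo, map_add, Finsupp.degree_single]
      omega
    · funext i
      rw [hL]
      simp only [coeff_sum, coeff_monomial]
      rw [Finset.sum_eq_single i]
      · simp
      · intro j _ hji
        rw [if_neg]
        intro he
        have := DFunLike.congr_fun he 1
        rw [expo_one, expo_one] at this
        exact hji (Fin.ext this)
      · simp
  rw [← hker, (L.quotKerEquivOfSurjective hsurj).finrank_eq]
  simp

/-- The zero-dimensional scheme `Z[b]` of degree `b` supported at the point `[x] = [(1,0)]`,
with ideal `(∂_y ^ b)`. -/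
noncomputable def pointScheme (b : ℕ) : ZeroDimSubscheme where
  ideal := Ideal.span {(X 1 : MvPolynomial (Fin 2) ℂ) ^ b}
  isHomogeneous := by
    intro G hG n
    rw [mem_span_X_pow_iff] at hG ⊢
    intro m hm
    rw [mem_support_iff, coeff_homogeneousComponent] at hm
    exact hG m (mem_support_iff.mpr fun h => hm (by simp [h]))
  saturated := by
    rintro G ⟨N, hN⟩
    have h := hN (X 0 ^ N) ((mem_homogeneousSubmodule N _).mpr (isHomogeneous_X_pow 0 N))
    rw [mem_span_X_pow_iff] at h ⊢
    intro m hm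
    have := h (m + Finsupp.single 0 N) (by
      rw [mem_support_iff, X_pow_eq_monomial, coeff_mul_monomial, mul_one]
      exact mem_support_iff.mp hm)
    simpa using this
  degree := b
  hilbert := Filter.eventually_atTop.mpr ⟨b, fun t ht => hilbert_span_X_pow b t ht⟩

end BinaryForms

/-! The tensor lies in the span of the Segre-Veronese image of a plane curve, and the dimension of
that span bounds the rank. With affine coordinates `s, t` on the two lines, take the curve `s^b₁ =
t^b₂`. Restricted to it, the monomials `s^i t^j` with `i ≤ d₁`, `j ≤ d₂` coincide along translates
by `(b₁, -b₂)`, so the dimension is at most the number of translation classes, which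
`card_image_exponentClass_le` bounds. A monomial with `i < b₁`, `j < b₂` is alone in its class, so
the matching basis tensor is itself in the span (`binomTerm_tmul_mem_curveSpan`). Membership in
`⟨ν_d(Z[b])⟩` confines `T_i` to the first `b_i` basis forms, so `T₁ ⊗ T₂` combines such tensors. -/

namespace BinaryForms

/-! ### Coordinates on binary forms and the span of a fat point -/

/-- The term `(d choose i) x^(d-i) y^i` of the expansion of `(x + y)^d`. -/
noncomputable def binomTerm (d i : ℕ) : SymPow d :=
  ⟨monomial (expo d i) (d.choose i : ℂ), by
    rw [mem_homogeneousSubmodule]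
    rcases le_or_gt i d with h | h
    · refine isHomogeneous_monomial _ ?_
      simp only [expo, map_add, Finsupp.degree_single]
      omega
    · rw [Nat.choose_eq_zero_of_lt h]
      simpa using isHomogeneous_zero (Fin 2) ℂ d⟩

theorem linForm_pow (d : ℕ) (v : Fin 2 → ℂ) :
    linForm v ^ d = ∑ i ∈ Finset.range (d + 1),
      monomial (expo d i) (v 0 ^ (d - i) * v 1 ^ i * d.choose i) := by
  rw [linForm, add_comm, add_pow]
  refine Finset.sum_congr rfl fun i _ => ?_
  rw [monomial_eq, Finsupp.prod_fintype _ _ (by simp)]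
  simp [expo, mul_pow]
  ring

theorem veronese_one (d : ℕ) (s : ℂ) :
    veronese d ![1, s] = ∑ i ∈ Finset.range (d + 1), s ^ i • binomTerm d i := by
  apply Subtype.ext
  simp [veronese, linForm_pow, binomTerm, smul_monomial]

theorem veronese_smul (d : ℕ) (c : ℂ) (v : Fin 2 → ℂ) :
    veronese d (c • v) = c ^ d • veronese d v := by
  apply Subtype.ext
  have h : linForm (c • v) = C c * linForm v := by
    simp [linForm]
    ring
  simp [veronese, h, mul_pow, smul_eq_C_mul]

theorem expo_injective (d : ℕ) : Function.Injective (expo d) := fun i j h => by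
  simpa [expo_one] using DFunLike.congr_fun h 1

theorem coeff_linForm_pow (d j : ℕ) (hj : j ≤ d) (v : Fin 2 → ℂ) :
    coeff (expo d j) (linForm v ^ d) = v 0 ^ (d - j) * v 1 ^ j * d.choose j := by
  classical
  rw [linForm_pow, coeff_sum, Finset.sum_eq_single j]
  · simp
  · intro i _ hij
    rw [coeff_monomial, if_neg fun h => hij (expo_injective d h)]
  · intro h
    exact absurd (Finset.mem_range.mpr (Nat.lt_succ_of_le hj)) h

/-- The coefficient functional pulls back under `ν_d` to a multiple of `∂_x^(d-j) ∂_y^j`, which lies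
in `(∂_y^b)` because `b ≤ j`. -/
theorem coeff_eq_zero_of_mem_veroneseSpan {d b j : ℕ} {T : SymPow d}
    (hT : T ∈ (pointScheme b).veroneseSpan d) (hbj : b ≤ j) (hj : j ≤ d) :
    coeff (expo d j) T.1 = 0 := by
  refine hT ((lcoeff ℂ (expo d j)) ∘ₗ (SymPow d).subtype)
    (C (d.choose j : ℂ) * X 0 ^ (d - j) * X 1 ^ j) (fun v => ?_) ?_
  · change _ = coeff (expo d j) (linForm v ^ d)
    rw [coeff_linForm_pow d j hj]
    simp
    ring
  · exact Ideal.mul_mem_left _ _ (Ideal.mem_span_singleton.mpr (pow_dvd_pow _ hbj))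

theorem eq_sum_binomTerm_of_mem_veroneseSpan {d b : ℕ} (hb : b ≤ d) {T : SymPow d}
    (hT : T ∈ (pointScheme b).veroneseSpan d) :
    ∃ a : ℕ → ℂ, T = ∑ i ∈ Finset.range b, a i • binomTerm d i := by
  classical
  refine ⟨fun i => coeff (expo d i) T.1 / d.choose i, Subtype.ext (MvPolynomial.ext _ _ fun m => ?_)⟩
  have hsum : ((∑ i ∈ Finset.range b, (coeff (expo d i) T.1 / d.choose i) • binomTerm d i :
      SymPow d) : MvPolynomial (Fin 2) ℂ) =
      ∑ i ∈ Finset.range b, monomial (expo d i) (coeff (expo d i) T.1) := by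
    rw [Submodule.coe_sum]
    refine Finset.sum_congr rfl fun i hi => ?_
    have h : (d.choose i : ℂ) ≠ 0 := by
      have := Finset.mem_range.mp hi
      exact_mod_cast (Nat.choose_pos (by omega)).ne'
    simp [binomTerm, smul_monomial, div_mul_cancel₀ _ h]
  rw [hsum, coeff_sum]
  simp only [coeff_monomial]
  by_cases hm : m.degree = d
  · obtain hlt | hle := lt_or_ge (m 1) b
    · rw [Finset.sum_eq_single (m 1)]
      · rw [← eq_expo hm, if_pos rfl]
      · intro i _ hi
        rw [if_neg]
        rintro rfl
        exact hi (expo_one d i).symm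
      · intro h
        exact absurd (Finset.mem_range.mpr hlt) h
    · rw [Finset.sum_eq_zero]
      · have hle' : m 1 ≤ d := by
          rw [← hm, Finsupp.degree_eq_sum]
          simp
        rw [eq_expo hm]
        exact coeff_eq_zero_of_mem_veroneseSpan hT hle hle'
      · intro i hi
        rw [if_neg]
        rintro rfl
        rw [expo_one] at hle
        exact absurd (Finset.mem_range.mp hi) (not_lt.mpr hle)
  · rw [Finset.sum_eq_zero, IsHomogeneous.coeff_eq_zero ((mem_homogeneousSubmodule d _).mp T.2) hm]
    intro i hi
    rw [if_neg]
    rintro rfl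
    have := Finset.mem_range.mp hi
    refine hm ?_
    simp only [expo, map_add, Finsupp.degree_single]
    omega

/-! ### Roots of unity and classes of exponents -/

/-- Averaging against a character of the `N`-th roots of unity extracts one residue class of
exponents. -/
theorem sum_filter_mem_of_forall_rootsOfUnity {ι M : Type*} [AddCommGroup M] [Module ℂ M]
    (V : Submodule ℂ M) {N : ℕ} (hN : N ≠ 0) (S : Finset ι) (k : ι → ℕ) (m : ι → M)
    (h : ∀ u : ℂ, u ^ N = 1 → ∑ p ∈ S, u ^ k p • m p ∈ V) (r : ℕ) :
    ∑ p ∈ S with k p ≡ r [MOD N], m p ∈ V := by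
  have hprim := Complex.isPrimitiveRoot_exp N hN
  set ω := Complex.exp (2 * Real.pi * Complex.I / N)
  have hω0 : ω ≠ 0 := Complex.exp_ne_zero _
  have hN' : (N : ℂ) ≠ 0 := Nat.cast_ne_zero.mpr hN
  have horth : ∀ e : ℕ, ∑ a ∈ Finset.range N, (ω ^ r)⁻¹ ^ a * (ω ^ a) ^ e =
      if e ≡ r [MOD N] then (N : ℂ) else 0 := by
    intro e
    have hterm : ∀ a, (ω ^ r)⁻¹ ^ a * (ω ^ a) ^ e = ((ω ^ r)⁻¹ * ω ^ e) ^ a := fun a => by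
      rw [mul_pow, ← pow_mul, ← pow_mul, mul_comm a e]
    simp only [hterm]
    have hiff : (ω ^ r)⁻¹ * ω ^ e = 1 ↔ e ≡ r [MOD N] := by
      rw [inv_mul_eq_one₀ (pow_ne_zero _ hω0), eq_comm,
        (hprim.isOfFinOrder hN).pow_eq_pow_iff_modEq, ← hprim.eq_orderOf]
    split_ifs with hc
    · simp [hiff.mpr hc]
    · have hne : (ω ^ r)⁻¹ * ω ^ e ≠ 1 := fun h => hc (hiff.mp h)
      rw [geom_sum_eq hne, mul_pow, inv_pow, ← pow_mul, ← pow_mul, mul_comm r, mul_comm e,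
        pow_mul, pow_mul, hprim.pow_eq_one]
      simp
  have hmem : ∑ a ∈ Finset.range N, (ω ^ r)⁻¹ ^ a • ∑ p ∈ S, (ω ^ a) ^ k p • m p ∈ V :=
    V.sum_mem fun a _ => V.smul_mem _ (h _ (by
      rw [← pow_mul, mul_comm, pow_mul, hprim.pow_eq_one, one_pow]))
  have heq : ∑ a ∈ Finset.range N, (ω ^ r)⁻¹ ^ a • ∑ p ∈ S, (ω ^ a) ^ k p • m p =
      (N : ℂ) • ∑ p ∈ S with k p ≡ r [MOD N], m p := by
    simp only [Finset.smul_sum, smul_smul]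
    rw [Finset.sum_comm, Finset.sum_filter]
    refine Finset.sum_congr rfl fun p _ => ?_
    rw [← Finset.sum_smul, horth]
    split_ifs <;> simp
  rw [heq] at hmem
  exact (V.smul_mem_iff hN').mp hmem

/-- The invariant of an exponent `(i, j)` modulo translation by `(b₁, -b₂)`. -/
def exponentClass (b₁ b₂ : ℕ) (p : ℕ × ℕ) : ℕ × ℕ :=
  (b₂ * p.1 + b₁ * p.2, p.2 % b₂)

/-- Translate by `(-b₁, b₂)`, which preserves the class, until the next move would leave the box. -/
theorem exists_reduced_exponent {d₁ d₂ b₁ b₂ : ℕ} (hb₁ : 0 < b₁) (i j : ℕ) (hi : i ≤ d₁)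
    (hj : j ≤ d₂) : ∃ i' j', i' ≤ d₁ ∧ j' ≤ d₂ ∧ (i' < b₁ ∨ d₂ < j' + b₂) ∧
      exponentClass b₁ b₂ (i', j') = exponentClass b₁ b₂ (i, j) := by
  induction i using Nat.strong_induction_on generalizing j with
  | _ i ih =>
    by_cases h : i < b₁ ∨ d₂ < j + b₂
    · exact ⟨i, j, hi, hj, h, rfl⟩
    · rw [not_or, not_lt, not_lt] at h
      obtain ⟨i', j', h1, h2, h3, h4⟩ := ih (i - b₁) (by omega) (j + b₂) (by omega) h.2
      refine ⟨i', j', h1, h2, h3, h4.trans ?_⟩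
      obtain ⟨e, rfl⟩ := Nat.exists_eq_add_of_le h.1
      simp only [exponentClass, Nat.add_sub_cancel_left, Nat.add_mod_right, Prod.mk.injEq, and_true]
      ring

theorem card_image_exponentClass_le {d₁ d₂ b₁ b₂ : ℕ} (hb₁ : 0 < b₁) :
    ((Finset.range (d₁ + 1) ×ˢ Finset.range (d₂ + 1)).image (exponentClass b₁ b₂)).card ≤
      b₁ * (d₂ + 1) + (d₁ + 1 - b₁) * b₂ := by
  classical
  have hsub : (Finset.range (d₁ + 1) ×ˢ Finset.range (d₂ + 1)).image (exponentClass b₁ b₂) ⊆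
      (Finset.range b₁ ×ˢ Finset.range (d₂ + 1) ∪
        Finset.Ico b₁ (d₁ + 1) ×ˢ Finset.Ico (d₂ + 1 - b₂) (d₂ + 1)).image
          (exponentClass b₁ b₂) := by
    intro c hc
    obtain ⟨⟨i, j⟩, hp, rfl⟩ := Finset.mem_image.mp hc
    simp only [Finset.mem_product, Finset.mem_range] at hp
    obtain ⟨i', j', h1, h2, h3, h4⟩ :=
      exists_reduced_exponent (b₂ := b₂) hb₁ i j (Nat.le_of_lt_succ hp.1) (Nat.le_of_lt_succ hp.2)
    refine Finset.mem_image.mpr ⟨(i', j'), ?_, h4⟩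
    simp only [Finset.mem_union, Finset.mem_product, Finset.mem_range, Finset.mem_Ico]
    omega
  -- Every class meets the strip `i < b₁` or the top `b₂` rows of the box, so counting these
  -- exponents suffices.
  refine (Finset.card_le_card hsub).trans (Finset.card_image_le.trans
    ((Finset.card_union_le _ _).trans ?_))
  simp only [Finset.card_product, Finset.card_range, Nat.card_Ico]
  gcongr
  omega

/-! ### The span of the curve -/

/-- The product of Veronese powers at the point `(s, t) = (u^b₂, z u^b₁)` of `ℙ¹ × ℙ¹`, which lies
on the curve `s^b₁ = t^b₂` when `z^b₂ = 1`. -/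
noncomputable def curvePoint (d₁ d₂ b₁ b₂ : ℕ) (q : ℂ × ℂ) : SymPow d₁ ⊗[ℂ] SymPow d₂ :=
  veronese d₁ ![1, q.1 ^ b₂] ⊗ₜ[ℂ] veronese d₂ ![1, q.2 * q.1 ^ b₁]

/-- The span of the points of the curve `s^b₁ = t^b₂`. -/
noncomputable def curveSpan (d₁ d₂ b₁ b₂ : ℕ) : Submodule ℂ (SymPow d₁ ⊗[ℂ] SymPow d₂) :=
  Submodule.span ℂ (curvePoint d₁ d₂ b₁ b₂ '' {q | q.2 ^ b₂ = 1})

theorem curvePoint_eq_sum (d₁ d₂ b₁ b₂ : ℕ) (u z : ℂ) :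
    curvePoint d₁ d₂ b₁ b₂ (u, z) = ∑ p ∈ Finset.range (d₁ + 1) ×ˢ Finset.range (d₂ + 1),
      u ^ (b₂ * p.1 + b₁ * p.2) • z ^ p.2 • (binomTerm d₁ p.1 ⊗ₜ[ℂ] binomTerm d₂ p.2) := by
  rw [curvePoint, veronese_one, veronese_one, TensorProduct.sum_tmul, Finset.sum_product]
  refine Finset.sum_congr rfl fun i _ => ?_
  rw [TensorProduct.tmul_sum]
  refine Finset.sum_congr rfl fun j _ => ?_
  rw [TensorProduct.smul_tmul_smul, smul_smul]
  congr 1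
  ring

/-- Since `z^b₂ = 1`, the coefficient of a basis tensor at a curve point depends only on its class,
so one generator per class suffices. -/
theorem curveSpan_le (d₁ d₂ b₁ b₂ : ℕ) :
    curveSpan d₁ d₂ b₁ b₂ ≤ Submodule.span ℂ
      ((fun c => ∑ p ∈ Finset.range (d₁ + 1) ×ˢ Finset.range (d₂ + 1) with
          exponentClass b₁ b₂ p = c, binomTerm d₁ p.1 ⊗ₜ[ℂ] binomTerm d₂ p.2) ''
        (((Finset.range (d₁ + 1) ×ˢ Finset.range (d₂ + 1)).image (exponentClass b₁ b₂) :
          Finset (ℕ × ℕ)) : Set (ℕ × ℕ))) := by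
  rw [curveSpan, Submodule.span_le]
  rintro _ ⟨⟨u, z⟩, hz, rfl⟩
  replace hz : z ^ b₂ = 1 := hz
  rw [curvePoint_eq_sum, SetLike.mem_coe,
    ← Finset.sum_fiberwise_of_maps_to (fun p hp => Finset.mem_image_of_mem (exponentClass b₁ b₂) hp)]
  refine Submodule.sum_mem _ fun c hc => ?_
  have h : ∑ p ∈ Finset.range (d₁ + 1) ×ˢ Finset.range (d₂ + 1) with exponentClass b₁ b₂ p = c,
      u ^ (b₂ * p.1 + b₁ * p.2) • z ^ p.2 • (binomTerm d₁ p.1 ⊗ₜ[ℂ] binomTerm d₂ p.2) =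
      (u ^ c.1 * z ^ c.2) •
        ∑ p ∈ Finset.range (d₁ + 1) ×ˢ Finset.range (d₂ + 1) with exponentClass b₁ b₂ p = c,
          binomTerm d₁ p.1 ⊗ₜ[ℂ] binomTerm d₂ p.2 := by
    rw [Finset.smul_sum]
    refine Finset.sum_congr rfl fun p hp => ?_
    obtain rfl := (Finset.mem_filter.mp hp).2
    rw [smul_smul]
    congr 2
    exact pow_eq_pow_mod _ hz
  rw [h]
  exact Submodule.smul_mem _ _ (Submodule.subset_span
    (Set.mem_image_of_mem _ (Finset.mem_coe.mpr hc)))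

theorem finrank_curveSpan_le {d₁ d₂ b₁ b₂ : ℕ} (hb₁ : 0 < b₁) :
    Module.finrank ℂ (curveSpan d₁ d₂ b₁ b₂) ≤ b₁ * (d₂ + 1) + (d₁ + 1 - b₁) * b₂ := by
  classical
  have h := curveSpan_le d₁ d₂ b₁ b₂
  rw [← Finset.coe_image] at h
  refine (Submodule.finrank_mono h).trans ?_
  refine (finrank_span_finset_le_card _).trans ?_
  exact Finset.card_image_le.trans (card_image_exponentClass_le hb₁)

/-- Averaging over `u` isolates one weight `b₂ i + b₁ j`, then averaging over `z` isolates `j`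
modulo `b₂`; together they cut out the class of `(i, j)`, a singleton. -/
theorem binomTerm_tmul_mem_curveSpan {d₁ d₂ b₁ b₂ i j : ℕ} (hi : i < b₁) (hj : j < b₂)
    (hid : i ≤ d₁) (hjd : j ≤ d₂) :
    binomTerm d₁ i ⊗ₜ[ℂ] binomTerm d₂ j ∈ curveSpan d₁ d₂ b₁ b₂ := by
  set S := Finset.range (d₁ + 1) ×ˢ Finset.range (d₂ + 1) with hS
  -- `N` exceeds every weight in the box, so congruence modulo `N` is equality.
  set N := b₂ * d₁ + b₁ * d₂ + 1 with hN
  have hlt : ∀ p ∈ S, b₂ * p.1 + b₁ * p.2 < N := fun p hp => by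
    simp only [hS, Finset.mem_product, Finset.mem_range, Nat.lt_succ_iff] at hp
    exact Nat.lt_succ_of_le
      (add_le_add (Nat.mul_le_mul_left _ hp.1) (Nat.mul_le_mul_left _ hp.2))
  have hij : (i, j) ∈ S := by simp [hS, hid, hjd]
  have h := sum_filter_mem_of_forall_rootsOfUnity (curveSpan d₁ d₂ b₁ b₂) (N := b₂) (by omega)
    (S.filter fun p => b₂ * p.1 + b₁ * p.2 ≡ b₂ * i + b₁ * j [MOD N]) (fun p => p.2)
    (fun p => binomTerm d₁ p.1 ⊗ₜ[ℂ] binomTerm d₂ p.2) (fun z hz =>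
      sum_filter_mem_of_forall_rootsOfUnity (curveSpan d₁ d₂ b₁ b₂) (N := N) (by omega) S
        (fun p => b₂ * p.1 + b₁ * p.2)
        (fun p => z ^ p.2 • (binomTerm d₁ p.1 ⊗ₜ[ℂ] binomTerm d₂ p.2)) (fun u _ => by
          rw [← curvePoint_eq_sum]
          exact Submodule.subset_span ⟨(u, z), hz, rfl⟩) (b₂ * i + b₁ * j)) j
  have hsingle : ((S.filter fun p => b₂ * p.1 + b₁ * p.2 ≡ b₂ * i + b₁ * j [MOD N]).filter
      fun p => p.2 ≡ j [MOD b₂]) = {(i, j)} := by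
    ext p
    simp only [Finset.mem_filter, Finset.mem_singleton]
    refine ⟨?_, fun h => by subst h; exact ⟨⟨hij, rfl⟩, rfl⟩⟩
    rintro ⟨⟨hp, h1⟩, h2⟩
    have h3 := Nat.ModEq.eq_of_lt_of_lt h1 (hlt p hp) (hlt _ hij)
    -- A class member is `(i - b₁ k, j + b₂ k)` with `k = p.2 / b₂ ≥ 0`; then `i < b₁` forces `k =
    -- 0`.
    have h4 : p.2 = j + b₂ * (p.2 / b₂) := by
      have := Nat.mod_add_div p.2 b₂
      rwa [h2, Nat.mod_eq_of_lt hj, eq_comm] at this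
    have h5 : p.1 + b₁ * (p.2 / b₂) = i := by
      rw [h4] at h3
      refine Nat.eq_of_mul_eq_mul_left (by omega : 0 < b₂) ?_
      have h6 : b₁ * (j + b₂ * (p.2 / b₂)) = b₁ * j + b₂ * (b₁ * (p.2 / b₂)) := by ring
      rw [mul_add]
      omega
    have h6 : p.2 / b₂ = 0 := by
      rcases Nat.eq_zero_or_pos (p.2 / b₂) with h | h
      · exact h
      · have := Nat.le_mul_of_pos_right b₁ h
        omega
    rw [h6] at h4 h5
    exact Prod.ext (by simpa using h5) (by simpa using h4)
  rwa [hsingle, Finset.sum_singleton] at h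

theorem tmul_mem_curveSpan {d₁ d₂ b₁ b₂ : ℕ} (hd₁ : b₁ ≤ d₁) (hd₂ : b₂ ≤ d₂)
    {T₁ : SymPow d₁} {T₂ : SymPow d₂} (hT₁ : T₁ ∈ (pointScheme b₁).veroneseSpan d₁)
    (hT₂ : T₂ ∈ (pointScheme b₂).veroneseSpan d₂) :
    T₁ ⊗ₜ[ℂ] T₂ ∈ curveSpan d₁ d₂ b₁ b₂ := by
  obtain ⟨a₁, rfl⟩ := eq_sum_binomTerm_of_mem_veroneseSpan hd₁ hT₁
  obtain ⟨a₂, rfl⟩ := eq_sum_binomTerm_of_mem_veroneseSpan hd₂ hT₂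
  rw [TensorProduct.sum_tmul]
  refine Submodule.sum_mem _ fun i hi => ?_
  rw [TensorProduct.tmul_sum]
  refine Submodule.sum_mem _ fun j hj => ?_
  rw [TensorProduct.smul_tmul_smul]
  have hi := Finset.mem_range.mp hi
  have hj := Finset.mem_range.mp hj
  exact Submodule.smul_mem _ _
    (binomTerm_tmul_mem_curveSpan hi hj (by omega) (by omega))

theorem moduleFinite_of_le {K M : Type*} [Field K] [AddCommMonoid M] [Module K M]
    {V W : Submodule K M} [hW : Module.Finite K W] (h : V ≤ W) : Module.Finite K V := by
  let _ : AddCommGroup M := Module.addCommMonoidToAddCommGroup K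
  have : FiniteDimensional K W := hW
  exact Submodule.finiteDimensional_of_le h

/-- Finitely many curve points, as many as the dimension, already span; each scalar is absorbed into
the first factor by a `d₁`-th root. -/
theorem partSymRank_le_finrank_curveSpan {d₁ d₂ b₁ b₂ : ℕ} (hd₁ : d₁ ≠ 0)
    {T : SymPow d₁ ⊗[ℂ] SymPow d₂} (hT : T ∈ curveSpan d₁ d₂ b₁ b₂) :
    partSymRank d₁ d₂ T ≤ Module.finrank ℂ (curveSpan d₁ d₂ b₁ b₂) := by
  have := FiniteDimensional.span_of_finite ℂ ((Finset.finite_toSet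
    ((Finset.range (d₁ + 1) ×ˢ Finset.range (d₂ + 1)).image (exponentClass b₁ b₂))).image
      (fun c => ∑ p ∈ Finset.range (d₁ + 1) ×ˢ Finset.range (d₂ + 1) with
        exponentClass b₁ b₂ p = c, binomTerm d₁ p.1 ⊗ₜ[ℂ] binomTerm d₂ p.2))
  have : Module.Finite ℂ (Submodule.span ℂ (curvePoint d₁ d₂ b₁ b₂ '' {q | q.2 ^ b₂ = 1})) :=
    moduleFinite_of_le (curveSpan_le d₁ d₂ b₁ b₂)
  obtain ⟨f, hf, hspan, -⟩ := Submodule.exists_fun_fin_finrank_span_eq ℂ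
    (curvePoint d₁ d₂ b₁ b₂ '' {q | q.2 ^ b₂ = 1})
  rw [curveSpan] at hT ⊢
  rw [← hspan, Submodule.mem_span_range_iff_exists_fun] at hT
  obtain ⟨c, rfl⟩ := hT
  choose q _ hq using hf
  choose e he using fun i => IsAlgClosed.exists_pow_nat_eq (c i) (Nat.pos_of_ne_zero hd₁)
  refine iInf₂_le _ ⟨fun i => e i • ![1, (q i).1 ^ b₂], fun i => ![1, (q i).2 * (q i).1 ^ b₁],
    Finset.sum_congr rfl fun i _ => ?_⟩
  rw [veronese_smul, he, ← hq i, curvePoint, TensorProduct.smul_tmul']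

end BinaryForms

/-- If `T₁`, `T₂` are binary forms of degrees `d₁`, `d₂` and cactus ranks `b₁`, `b₂` that lie in the
span of the degree `b_i` scheme supported at `[x]`, with `2 ≤ b_i ≤ d_i / 2`, then the partially
symmetric rank of `T₁ ⊗ T₂` is at most `d₁ b₂ + d₂ b₁ + b₁ b₂ - 1`. -/
theorem propositionb1 (d₁ d₂ b₁ b₂ : ℕ)
    (hb₁ : 2 ≤ b₁) (hd₁ : 2 * b₁ ≤ d₁) (hb₂ : 2 ≤ b₂) (hd₂ : 2 * b₂ ≤ d₂)
    (T₁ : BinaryForms.SymPow d₁) (T₂ : BinaryForms.SymPow d₂)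
    (hc₁ : BinaryForms.cactusRank d₁ T₁ = b₁)
    (hT₁ : T₁ ∈ (BinaryForms.pointScheme b₁).veroneseSpan d₁)
    (hc₂ : BinaryForms.cactusRank d₂ T₂ = b₂)
    (hT₂ : T₂ ∈ (BinaryForms.pointScheme b₂).veroneseSpan d₂) :
    BinaryForms.partSymRank d₁ d₂ (T₁ ⊗ₜ[ℂ] T₂) ≤
      ((d₁ * b₂ + d₂ * b₁ + b₁ * b₂ - 1 : ℕ) : ℕ∞) := by
  have hb₁' : 0 < b₁ := by omega
  refine (BinaryForms.partSymRank_le_finrank_curveSpan (by omega)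
    (BinaryForms.tmul_mem_curveSpan (by omega) (by omega) hT₁ hT₂)).trans ?_
  refine Nat.cast_le.mpr ((BinaryForms.finrank_curveSpan_le hb₁').trans ?_)
  obtain ⟨e, rfl⟩ := Nat.exists_eq_add_of_le (show b₁ ≤ d₁ by omega)
  rw [show b₁ + e + 1 - b₁ = e + 1 by omega]
  refine Nat.le_sub_one_of_lt ?_
  -- What remains is `b₁ + b₂ < 2 b₁ b₂`.
  nlinarith [mul_le_mul hb₁ hb₂ (by omega) (by omega)]
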